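/- All topological groups are Hausdorff. A topological group $G$ is called minimal if every Hausdorff group topology on $G$ that is coarser than the given topology coincides with it; $G$ is called totally minimal if for every closed normal subgroup $N$ of $G$ the quotient group $G/N$, with the quotient topology, is minimal. Let $F$ be a subfield of $\mathbb{R}$ with the subspace topology and let $n$ be an odd positive integer. Let $\mathrm{GL}(n,F)$ carry the topology inherited from $F^{n^2}$, and let $\mathrm{PGL}(n,F)=\mathrm{GL}(n,F)/Z(\mathrm{GL}(n,F))$ carry the quotient topology. Then $\mathrm{PGL}(n,F)$ is totally minimal. -/

import Mathlib

/-- A Hausdorff topological group `G` is *minimal* if its topology has no strictly coarser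
Hausdorff group topology. (In Mathlib's order, `s ≤ t` says that `t` is coarser than `s`.) -/
def IsMinimalGroup (G : Type*) [Group G] [σ : TopologicalSpace G] [IsTopologicalGroup G] : Prop :=
  T2Space G ∧
    ∀ τ : TopologicalSpace G, σ ≤ τ → @IsTopologicalGroup G τ _ → @T2Space G τ → τ = σ

/-- A Hausdorff topological group `G` is *totally minimal* if each of its Hausdorff quotient
groups, that is, each `G ⧸ N` with `N` a closed normal subgroup, carrying the quotient topology,
is minimal. -/
def IsTotallyMinimalGroup (G : Type*) [Group G] [TopologicalSpace G] [IsTopologicalGroup G] :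
    Prop :=
  T2Space G ∧
    ∀ (N : Subgroup G) [N.Normal], IsClosed (N : Set G) → IsMinimalGroup (G ⧸ N)

/-- For a topological field, the topology of `GL n F` (Mathlib's topology of the group of units of
the matrix ring) is the pointwise topology inherited from the space of all matrices. -/
theorem GL_isEmbedding_val (n : ℕ) (F : Type*) [Field F] [TopologicalSpace F]
    [IsTopologicalDivisionRing F] :
    Topology.IsEmbedding (fun g : Matrix.GeneralLinearGroup (Fin n) F =>
      (g : Matrix (Fin n) (Fin n) F)) := by
  refine Units.isEmbedding_val_mk' (f := fun A => A⁻¹) ?_ ?_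
  · intro A hA
    have hA' : A.det ≠ 0 := ((Matrix.isUnit_iff_isUnit_det A).1 hA).ne_zero
    have h : ContinuousWithinAt
        (fun B : Matrix (Fin n) (Fin n) F => (B.det)⁻¹ • B.adjugate) {B | IsUnit B} A :=
      (((continuous_id.matrix_det.continuousAt).inv₀ hA').smul
        (continuous_id.matrix_adjugate.continuousAt)).continuousWithinAt
    simpa [Matrix.inv_def] using h
  · intro u
    simp

/-- `PGL(n, F) = GL(n, F) / Z(GL(n, F))` carries the quotient topology. -/
instance (n : ℕ) (F : Type*) [Field F] [TopologicalSpace F] :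
    TopologicalSpace (Matrix.ProjGenLinGroup (Fin n) F) :=
  inferInstanceAs (TopologicalSpace
    (Matrix.GeneralLinearGroup (Fin n) F ⧸
      Subgroup.center (Matrix.GeneralLinearGroup (Fin n) F)))

instance (n : ℕ) (F : Type*) [Field F] [TopologicalSpace F] [IsTopologicalRing F] :
    IsTopologicalGroup (Matrix.ProjGenLinGroup (Fin n) F) :=
  inferInstanceAs (IsTopologicalGroup
    (Matrix.GeneralLinearGroup (Fin n) F ⧸
      Subgroup.center (Matrix.GeneralLinearGroup (Fin n) F)))

/-!
The proof has an algebraic and a topological half. The case `n = 1` is trivial, so let `n ≥ 3`.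

*Algebra.* A normal subgroup of `GL ι K` with `3 ≤ card ι` that contains a non-scalar element
contains every elementary transvection (`transvection_mem_of_notMem_center`).

*Closed normal subgroups.* Let `N` be a closed normal subgroup of `GL(n, F)` that contains the
scalars and a non-scalar element. Modulo `N` all the matrices `diag(1, …, u, …, 1)`, with `u` in any
position, agree, and their product over the positions is scalar; hence `diag(1, …, uⁿ, …, 1)` lies
in `N`. As `n` is odd, the `n`-th powers are dense in `Fˣ`, so `N` is everything
(`eq_top_of_isClosed_of_notMem_center`). Thus the only closed normal subgroups of `PGL(n, F)` are
the trivial ones, and it remains to show that `PGL(n, F)` is minimal.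

*Minimality.* Let `τ` be a coarser Hausdorff group topology on `PGL(n, F)`, let
`π : GL(n, F) → PGL(n, F)` be the projection and `M` the pullback under `π` of the filter of
`τ`-neighbourhoods of `1`. The cluster points of `M` in `GL(n, ℝ)` form a closed subgroup
(`limitSubgroup`), which is normal because `GL(n, F)` is dense in `GL(n, ℝ)`, and which meets
`GL(n, F)` only in scalars because `τ` is Hausdorff. By the algebraic half it consists of scalars
(`limitSubgroup_le_center`). It remains to produce cluster points.

* The products of an entry of `g` and an entry of `g⁻¹` are bounded along `M`
  (`exists_eventually_abs_mul_inv_le`). Otherwise let `v` be the largest such product, from column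
  `i` of `g` and row `j` of `g⁻¹`. Along an ultrafilter where `|v| → ∞`, the elements
  `x = 1 + v⁻¹ eᵢ eⱼᵀ` tend to `1` in the original topology, so `g x g⁻¹` still tends to `1` for `τ`;
  but its matrices are `1 + R` with `R` of rank one and largest entry `1`. They accumulate at a
  non-scalar element of the limit subgroup, a contradiction.
* Hence, for an ultrafilter `U ≤ M`, dividing each `g` by its largest entry makes both `g` and `g⁻¹`
  bounded. The limit along `U` is invertible, so it is in the limit subgroup and is scalar; having
  an entry `1`, it is `1`. So `π g` tends to `1` in the original topology
  (`exists_lift_tendsto_one`).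
-/

open Matrix Filter Topology

/-! ### Normal subgroups of the general linear group -/

section NormalSubgroups

variable {ι K : Type*} [Fintype ι] [DecidableEq ι] [Field K]

/-- A normal subgroup that contains `1 + a bᵀ` contains its conjugate by `g`, which is
`1 + (g a) (b g⁻¹)ᵀ`. -/
theorem exists_mem_eq_one_add_vecMulVec_of_conj (N : Subgroup (GL ι K)) [N.Normal]
    {a b a' b' : ι → K}
    (g : GL ι K) (ha : g.1 *ᵥ a = a') (hb : b' ᵥ* g.1 = b) :
    (∃ x ∈ N, x.1 = 1 + vecMulVec a b) ↔ ∃ x ∈ N, x.1 = 1 + vecMulVec a' b' := by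
  have key : g.1 * (1 + vecMulVec a b) = (1 + vecMulVec a' b') * g.1 := by
    rw [mul_add, add_mul, mul_one, one_mul, mul_vecMulVec, vecMulVec_mul, ha, hb]
  constructor
  · rintro ⟨x, hx, hxe⟩
    refine ⟨g * x * g⁻¹, ‹N.Normal›.conj_mem x hx g, ?_⟩
    rw [Units.val_mul, Units.val_mul, hxe, key, mul_assoc, Units.mul_inv, mul_one]
  · rintro ⟨x, hx, hxe⟩
    refine ⟨g⁻¹ * x * g, by simpa using ‹N.Normal›.conj_mem x hx g⁻¹, ?_⟩
    rw [Units.val_mul, Units.val_mul, hxe, mul_assoc, ← key, ← mul_assoc, Units.inv_mul, one_mul]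

/-- The transvection `1 + a bᵀ`, where `b ⬝ᵥ a = 0`, with inverse `1 - a bᵀ`. Here `a` or `b` may
be zero. -/
def transvectionUnit (a b : ι → K) (h : b ⬝ᵥ a = 0) : GL ι K where
  val := 1 + vecMulVec a b
  inv := 1 - vecMulVec a b
  val_inv := by
    have : vecMulVec a b * vecMulVec a b = 0 := by simp [vecMulVec_mul_vecMulVec, h]
    simp [mul_sub, add_mul, this]
  inv_val := by
    have : vecMulVec a b * vecMulVec a b = 0 := by simp [vecMulVec_mul_vecMulVec, h]
    simp [mul_add, sub_mul, this]

omit [DecidableEq ι] in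
theorem exists_ne_zero_dotProduct_pair_eq_zero (hι : 3 ≤ Fintype.card ι) (b c : ι → K) :
    ∃ w : ι → K, w ≠ 0 ∧ b ⬝ᵥ w = 0 ∧ c ⬝ᵥ w = 0 := by
  have h := LinearMap.ker_ne_bot_of_finrank_lt (K := K) (f := (Matrix.of ![b, c]).mulVecLin)
    (by simpa using Nat.lt_of_succ_le hι)
  obtain ⟨w, hw, hw0⟩ := Submodule.exists_mem_ne_zero_of_ne_bot h
  have hw' : Matrix.of ![b, c] *ᵥ w = 0 := hw
  exact ⟨w, hw0, congrFun hw' 0, congrFun hw' 1⟩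

/-- Two successive commutators turn a non-scalar element into a transvection: `C = [A, T]`, with `T`
an elementary transvection that does not commute with `A`, fixes a vector `w ≠ 0` and satisfies
`rank (C - 1) ≤ 2`. Then either `[C, 1 + w ψᵀ]` is a nontrivial transvection for some `ψ`, or `C`
is one itself. -/
theorem exists_transvection_mem (N : Subgroup (GL ι K)) [hN : N.Normal]
    (hι : 3 ≤ Fintype.card ι) {A : GL ι K} (hA : A ∈ N) (hAc : A ∉ Subgroup.center (GL ι K)) :
    ∃ w c : ι → K, w ≠ 0 ∧ c ≠ 0 ∧ c ⬝ᵥ w = 0 ∧ ∃ x ∈ N, x.1 = 1 + vecMulVec w c := by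
  obtain ⟨t, ht⟩ : ∃ t : TransvectionStruct ι K, ¬ Commute t.toMatrix A.1 := by
    by_contra! h
    exact hAc (GeneralLinearGroup.mem_center_iff_val_mem_range_scalar.2
      (mem_range_scalar_of_commute_transvectionStruct h))
  let T : GL ι K := ⟨t.toMatrix, t.inv.toMatrix, t.mul_inv, t.inv_mul⟩
  let C : GL ι K := A * (T * A⁻¹ * T⁻¹)
  have hC : C ∈ N := N.mul_mem hA (hN.conj_mem _ (N.inv_mem hA) T)
  have hC1 : C ≠ 1 := by
    intro h
    apply ht
    have : A * T = T * A := by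
      rw [← mul_inv_eq_one, ← h]; simp [C, mul_assoc]
    exact (congrArg Units.val this).symm
  obtain ⟨w, hw, hw1, hw2⟩ := exists_ne_zero_dotProduct_pair_eq_zero hι
    (Pi.single t.j 1) (Pi.single t.j 1 ᵥ* (A⁻¹).1)
  have hT (v : ι → K) (hv : Pi.single t.j 1 ⬝ᵥ v = 0) : T.1 *ᵥ v = v := by
    change (1 + single t.i t.j t.c) *ᵥ v = v
    have : v t.j = 0 := by simpa using hv
    simp [add_mulVec, single_mulVec_eq, this]
  have hinv (B : GL ι K) (v : ι → K) (h : B.1 *ᵥ v = v) : (B⁻¹).1 *ᵥ v = v := by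
    conv_lhs => rw [← h]
    rw [mulVec_mulVec, Units.inv_mul, one_mulVec]
  have hCw : C.1 *ᵥ w = w := by
    change (A.1 * (T.1 * (A⁻¹).1 * (T⁻¹).1)) *ᵥ w = w
    rw [← mulVec_mulVec, ← mulVec_mulVec, ← mulVec_mulVec, hinv T w (hT w hw1),
      hT _ (by rw [dotProduct_mulVec, hw2]), mulVec_mulVec, Units.mul_inv, one_mulVec]
  -- `[C, 1 + w ψᵀ] = 1 + w (ψ C⁻¹ - ψ)ᵀ` because `C w = w`.
  by_cases hψ : ∃ ψ : ι → K, ψ ⬝ᵥ w = 0 ∧ ψ ᵥ* (C⁻¹).1 ≠ ψ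
  · obtain ⟨ψ, hψw, hψ⟩ := hψ
    let S := transvectionUnit w ψ hψw
    refine ⟨w, ψ ᵥ* (C⁻¹).1 - ψ, hw, sub_ne_zero.2 hψ, ?_, C * (S * C⁻¹ * S⁻¹),
      N.mul_mem hC (hN.conj_mem _ (N.inv_mem hC) S), ?_⟩
    · rw [sub_dotProduct, ← dotProduct_mulVec, hinv C w hCw, hψw, sub_zero]
    · have h1 : C.1 * S.1 * (C⁻¹).1 = 1 + vecMulVec w (ψ ᵥ* (C⁻¹).1) := by
        change C.1 * (1 + vecMulVec w ψ) * _ = _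
        rw [mul_add, add_mul, mul_one, Units.mul_inv, mul_vecMulVec, hCw, vecMulVec_mul]
      have h2 : (S⁻¹).1 = 1 - vecMulVec w ψ := rfl
      rw [← mul_assoc, ← mul_assoc, Units.val_mul, Units.val_mul, Units.val_mul, h1, h2]
      rw [mul_sub, mul_one, add_mul, one_mul, vecMulVec_mul_vecMulVec, ← dotProduct_mulVec,
        hinv C w hCw, hψw]
      simp [vecMulVec_sub]
      abel
  · push Not at hψ
    -- Every functional that kills `w` kills `C - 1`, so the columns of `C - 1` are multiples of `w`.
    obtain ⟨p, hp⟩ := Function.ne_iff.1 hw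
    simp only [Pi.zero_apply] at hp
    have hR (k l : ι) : w p * (C.1 - 1) k l = w k * (C.1 - 1) p l := by
      have h1 := hψ (w p • Pi.single k 1 - w k • Pi.single p 1)
        (by simp [sub_dotProduct, mul_comm])
      have h2 : (w p • Pi.single k 1 - w k • Pi.single p 1) ᵥ* (C.1 - 1) = 0 := by
        rw [vecMul_sub, vecMul_one]
        conv_lhs => enter [1]; rw [← h1]
        rw [vecMul_vecMul, Units.inv_mul, vecMul_one, sub_self]
      have h3 := congrFun h2 l
      simpa [sub_vecMul, smul_vecMul, sub_eq_zero] using h3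
    have hCe : C.1 - 1 = vecMulVec w (fun l => (C.1 - 1) p l / w p) := by
      ext k l
      rw [vecMulVec_apply, mul_div_assoc', ← hR, mul_div_cancel_left₀ _ hp]
    refine ⟨w, _, hw, ?_, ?_, C, hC, by rw [← hCe]; abel⟩
    · intro h
      rw [h, vecMulVec_zero, sub_eq_zero] at hCe
      exact hC1 (Units.ext hCe)
    · have h4 : (C.1 - 1) *ᵥ w = 0 := by rw [sub_mulVec, hCw, one_mulVec, sub_self]
      rw [hCe, vecMulVec_mulVec] at h4
      simpa [hw] using h4

/-- All nontrivial transvections are conjugate in the general linear group. -/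
theorem transvection_mem_of_exists (N : Subgroup (GL ι K)) [N.Normal] {w c : ι → K} (hw : w ≠ 0)
    (hc : c ≠ 0) (hcw : c ⬝ᵥ w = 0) (hN : ∃ x ∈ N, x.1 = 1 + vecMulVec w c)
    {i j : ι} (hij : i ≠ j) (r : K) (hr : r ≠ 0) :
    ∃ x ∈ N, x.1 = transvection i j r := by
  obtain ⟨q, hq⟩ := Function.ne_iff.1 hc
  simp only [Pi.zero_apply] at hq
  have hs (k : ι) : (Pi.single k 1 : ι → K) ≠ 0 := by simp
  have h1 : Projectivization.mk K (Pi.single i 1 : ι → K) (hs i) ≠ .mk K (Pi.single j 1) (hs j) := by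
    rw [Ne, Projectivization.mk_eq_mk_iff']
    rintro ⟨a, ha⟩
    simpa [hij] using congrFun ha i
  have h2 : Projectivization.mk K w hw ≠ .mk K (Pi.single q 1) (hs q) := by
    rw [Ne, Projectivization.mk_eq_mk_iff']
    rintro ⟨a, rfl⟩
    simp_all
  -- `g` maps the lines of `eᵢ`, `eⱼ` to those of `w`, `e_q`, so conjugation by `g⁻¹` makes `w` a
  -- multiple of `eᵢ` and gives the functional a nonzero `j`-th coordinate.
  obtain ⟨g, hg1, hg2⟩ := (MulAction.is_two_pretransitive_iff
    (G := SpecialLinearGroup ι K)).1 inferInstance h1 h2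
  rw [Projectivization.smul_mk, Projectivization.mk_eq_mk_iff'] at hg1 hg2
  obtain ⟨a, ha⟩ := hg1
  obtain ⟨b, hb⟩ := hg2
  change a • w = g.1 *ᵥ _ at ha
  change b • _ = g.1 *ᵥ _ at hb
  have hginj (v : ι → K) (h : g.1 *ᵥ v = 0) : v = 0 :=
    eq_zero_of_mulVec_eq_zero (by rw [g.2]; exact one_ne_zero) h
  have ha0 : a ≠ 0 := by
    rintro rfl
    exact hs i (hginj _ (by rw [← ha, zero_smul]))
  have hb0 : b ≠ 0 := by
    rintro rfl
    exact hs j (hginj _ (by rw [← hb, zero_smul]))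
  let d := c ᵥ* g.1
  have hdi : d i = 0 := by
    have : d ⬝ᵥ Pi.single i 1 = 0 := by
      rw [← dotProduct_mulVec, ← ha]; simp [hcw]
    simpa using this
  have hdj : d j ≠ 0 := by
    have : d ⬝ᵥ Pi.single j 1 = b * c q := by
      rw [← dotProduct_mulVec, ← hb]; simp
    simp at this
    rw [this]; exact mul_ne_zero hb0 hq
  have step1 : ∃ x ∈ N, x.1 = 1 + vecMulVec (a⁻¹ • Pi.single i 1) d := by
    refine (exists_mem_eq_one_add_vecMulVec_of_conj N (g : GL ι K) ?_ rfl).2 hN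
    change g.1 *ᵥ _ = _
    rw [mulVec_smul, ← ha, inv_smul_smul₀ ha0]
  -- Conjugation by the identity matrix with row `j` replaced by `e` fixes `eᵢ` and maps the functional
  -- `d` to a multiple of the `j`-th coordinate; the factor in `e` makes that multiple the right one.
  let e := (a * r)⁻¹ • d
  have hdet : (updateRow 1 j e).det ≠ 0 := by
    have : (updateRow 1 j e).det = e j := by
      rw [← cramer_transpose_apply, transpose_one, cramer_one]
      rfl
    rw [this]
    exact mul_ne_zero (inv_ne_zero (mul_ne_zero ha0 hr)) hdj
  have step2 := (exists_mem_eq_one_add_vecMulVec_of_conj N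
    (a' := a⁻¹ • Pi.single i 1) (b' := (a * r) • Pi.single j 1)
    (GeneralLinearGroup.mkOfDetNeZero _ hdet) ?_ ?_).1 step1
  · obtain ⟨x, hx, hxe⟩ := step2
    refine ⟨x, hx, hxe.trans ?_⟩
    rw [transvection, smul_vecMulVec, vecMulVec_smul]
    congr 1
    ext k l
    by_cases hk : k = i <;> by_cases hl : l = j <;>
      simp [vecMulVec_apply, hk, hl, @eq_comm _ i, @eq_comm _ j, ha0]
  · change updateRow 1 j e *ᵥ _ = _
    ext k
    by_cases hk : k = j
    · simp [mulVec_smul, hk, hij.symm, e, hdi]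
    · simp [mulVec_smul, hk, one_apply, Pi.single_apply]
  · change _ ᵥ* updateRow 1 j e = _
    rw [smul_vecMul]
    ext k
    simp [e]
    field_simp

end NormalSubgroups

section Diagonal

variable {ι K : Type*} [Fintype ι] [DecidableEq ι] [Field K]

/-- The invertible diagonal matrices, as a group homomorphism from tuples of units. -/
def diagonalUnits (ι K : Type*) [Fintype ι] [DecidableEq ι] [Field K] : (ι → Kˣ) →* GL ι K :=
  (Units.map (diagonalRingHom ι K).toMonoidHom).comp MulEquiv.piUnits.symm.toMonoidHom

theorem diagonalUnits_val (d : ι → Kˣ) :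
    (diagonalUnits ι K d).1 = diagonal (fun i => (d i : K)) := rfl

/-- A normal subgroup of `GL ι K` with a non-scalar element contains all elementary transvections,
if `ι` has at least three elements. -/
theorem transvection_mem_of_notMem_center (N : Subgroup (GL ι K)) [N.Normal]
    (hι : 3 ≤ Fintype.card ι) {A : GL ι K} (hA : A ∈ N) (hAc : A ∉ Subgroup.center (GL ι K))
    (t : TransvectionStruct ι K) : ∃ x ∈ N, x.1 = t.toMatrix := by
  obtain ⟨w, c, hw, hc, hcw, hN⟩ := exists_transvection_mem N hι hA hAc
  by_cases hr : t.c = 0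
  · exact ⟨1, N.one_mem, by simp [TransvectionStruct.toMatrix, hr]⟩
  · exact transvection_mem_of_exists N hw hc hcw hN t.hij t.c hr

/-- Modulo the transvections, `diag(1, …, u, …, 1)` does not depend on the position of `u`. -/
theorem diagonalUnits_mulSingle_div_mem (N : Subgroup (GL ι K)) [hN : N.Normal]
    (ht : ∀ t : TransvectionStruct ι K, ∃ x ∈ N, x.1 = t.toMatrix) (i j : ι) (u : Kˣ) :
    diagonalUnits ι K (Pi.mulSingle i u / Pi.mulSingle j u) ∈ N := by
  rcases eq_or_ne i j with rfl | hij
  · simp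
  obtain ⟨x, hx, hxe⟩ := ht ⟨j, i, hij.symm, 1⟩
  obtain ⟨y, hy, hye⟩ := ht ⟨i, j, hij, -1⟩
  -- The product `x y x` is a signed transposition of `i` and `j`.
  have hg : x * y * x ∈ N := N.mul_mem (N.mul_mem hx hy) hx
  generalize hgd : x * y * x = g at hg
  have key : g * diagonalUnits ι K (Pi.mulSingle i u) = diagonalUnits ι K (Pi.mulSingle j u) * g := by
    have hgv : g.1 = 1 - single i i 1 - single j j 1 + single j i 1 - single i j 1 := by
      have hy' : y.1 = 1 - single i j 1 := by
        rw [hye, TransvectionStruct.toMatrix, transvection, ← single_neg, sub_eq_add_neg]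
      have hx' : x.1 = 1 + single j i 1 := hxe
      rw [← hgd, Units.val_mul, Units.val_mul, hx', hy']
      simp [mul_sub, add_mul, mul_add, sub_mul, hij]
      abel
    have hdv (k : ι) : (diagonalUnits ι K (Pi.mulSingle k u)).1 = 1 + single k k (u.1 - 1) := by
      rw [diagonalUnits_val]
      ext a b
      by_cases hab : a = b <;> by_cases hk : k = a <;>
        simp_all [Pi.mulSingle_apply, one_apply, eq_comm]
    apply Units.ext
    rw [Units.val_mul, Units.val_mul _ g, hdv, hdv, hgv]
    simp [mul_add, add_mul, sub_mul, mul_sub, hij.symm]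
    abel
  have h := N.mul_mem (hN.conj_mem _ hg (diagonalUnits ι K (Pi.mulSingle i u))) (N.inv_mem hg)
  rwa [mul_assoc, mul_assoc, ← _root_.mul_inv_rev, key, _root_.mul_inv_rev, mul_inv_cancel_left,
    ← div_eq_mul_inv, ← map_div] at h

/-- Modulo `N`, the `card ι`-th power of `diag(1, …, u, …, 1)` is the scalar matrix `u`. -/
theorem diagonalUnits_mulSingle_pow_mem (N : Subgroup (GL ι K)) [hN : N.Normal]
    (hc : Subgroup.center (GL ι K) ≤ N)
    (ht : ∀ t : TransvectionStruct ι K, ∃ x ∈ N, x.1 = t.toMatrix) (i : ι) (u : Kˣ) :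
    diagonalUnits ι K (Pi.mulSingle i (u ^ Fintype.card ι)) ∈ N := by
  have h1 : diagonalUnits ι K (fun _ => u) ∈ N :=
    hc (GeneralLinearGroup.mem_center_iff_val_mem_range_scalar.2 ⟨u, by
      rw [diagonalUnits_val]; simp⟩)
  have h2 : ∏ j, (Pi.mulSingle i u / Pi.mulSingle j u) ∈ N.comap (diagonalUnits ι K) :=
    Subgroup.prod_mem _ fun j _ => diagonalUnits_mulSingle_div_mem N ht i j u
  have h3 : Pi.mulSingle i (u ^ Fintype.card ι) ∈ N.comap (diagonalUnits ι K) := by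
    have h4 := Subgroup.mul_mem _ h2 (show (fun _ => u) ∈ N.comap (diagonalUnits ι K) from h1)
    rw [Finset.prod_div_distrib, Finset.univ_prod_mulSingle (fun _ => u), div_mul_cancel] at h4
    simpa [Pi.mulSingle_pow] using h4
  exact h3

theorem eq_top_of_diagonalUnits_mulSingle_mem (N : Subgroup (GL ι K))
    (ht : ∀ t : TransvectionStruct ι K, ∃ x ∈ N, x.1 = t.toMatrix)
    (hd : ∀ (i : ι) (u : Kˣ), diagonalUnits ι K (Pi.mulSingle i u) ∈ N) : N = ⊤ := by
  refine (Subgroup.eq_top_iff' N).2 fun g => ?_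
  suffices h : ∃ x ∈ N, x.1 = g.1 by
    obtain ⟨x, hx, hxe⟩ := h
    rwa [← Units.ext hxe]
  refine diagonal_transvection_induction_of_det_ne_zero
    (fun M => ∃ x ∈ N, x.1 = M) g.1 (GeneralLinearGroup.det_ne_zero g) ?_ ht ?_
  · intro D hD
    rw [det_diagonal, Finset.prod_ne_zero_iff] at hD
    let d : ι → Kˣ := fun i => Units.mk0 (D i) (hD i (Finset.mem_univ i))
    refine ⟨diagonalUnits ι K d, ?_, rfl⟩
    have : ∏ i, Pi.mulSingle i (d i) ∈ N.comap (diagonalUnits ι K) :=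
      Subgroup.prod_mem _ fun j _ => hd j _
    rwa [Finset.univ_prod_mulSingle] at this
  · rintro A B - - ⟨x, hx, rfl⟩ ⟨y, hy, rfl⟩
    exact ⟨x * y, N.mul_mem hx hy, rfl⟩

end Diagonal

/-! ### Closed normal subgroups -/

theorem exists_pow_eq_of_odd {n : ℕ} (hn : Odd n) (x : ℝ) : ∃ r : ℝ, r ^ n = x := by
  rcases le_total 0 x with hx | hx
  · exact ⟨x ^ (n⁻¹ : ℝ), Real.rpow_inv_natCast_pow hx hn.pos.ne'⟩
  · exact ⟨-(-x) ^ (n⁻¹ : ℝ), by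
      rw [hn.neg_pow, Real.rpow_inv_natCast_pow (neg_nonneg.2 hx) hn.pos.ne', neg_neg]⟩

/-- A closed normal subgroup of `GL(n, F)`, `n` odd, that contains the scalars properly is the whole
group. -/
theorem eq_top_of_isClosed_of_notMem_center (F : Subfield ℝ) (n : ℕ) (hn : Odd n) (hn3 : 3 ≤ n)
    (N : Subgroup (GL (Fin n) F)) [hN : N.Normal] (hc : Subgroup.center (GL (Fin n) F) ≤ N)
    (hcl : IsClosed (N : Set (GL (Fin n) F)))
    {A : GL (Fin n) F} (hA : A ∈ N) (hAc : A ∉ Subgroup.center (GL (Fin n) F)) : N = ⊤ := by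
  have ht := transvection_mem_of_notMem_center N (by simpa using hn3) hA hAc
  refine eq_top_of_diagonalUnits_mulSingle_mem N ht fun i u => ?_
  obtain ⟨r, hr⟩ := exists_pow_eq_of_odd hn (u.1 : ℝ)
  have hr0 : r ≠ 0 := by
    rintro rfl
    rw [zero_pow hn.pos.ne'] at hr
    exact u.ne_zero (Subtype.ext hr.symm)
  -- Rational approximations of the real `n`-th root of `u` lie in `F`.
  obtain ⟨q, -, -, hq⟩ := Real.exists_seq_rat_strictMono_tendsto r
  have hq0 : ∀ᶠ k in atTop, (q k : ℝ) ≠ 0 := hq.eventually_ne hr0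
  let v : ℕ → (F)ˣ := fun k => if h : (q k : F) = 0 then 1 else Units.mk0 (q k : F) h
  have hv : Tendsto (fun k => ((v k ^ n : (F)ˣ) : F)) atTop (𝓝 u.1) := by
    rw [tendsto_subtype_rng, ← hr]
    refine (hq.pow n).congr' ?_
    filter_upwards [hq0] with k hk
    have hk' : (q k : F) ≠ 0 := fun h => hk (by simpa using congrArg Subtype.val h)
    simp only [v, dif_neg hk']
    simp
  refine hcl.mem_of_tendsto (f := fun k => diagonalUnits (Fin n) F (Pi.mulSingle i (v k ^ n)))
    (b := atTop) ?_ (.of_forall fun k => ?_)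
  · rw [(GL_isEmbedding_val n F).tendsto_nhds_iff]
    have hc : Continuous (fun x : F => diagonal (Function.update (1 : Fin n → F) i x)) :=
      (continuous_const.update i continuous_id).matrix_diagonal
    have hval (w : (F)ˣ) : (diagonalUnits (Fin n) F (Pi.mulSingle i w)).1 =
        diagonal (Function.update (1 : Fin n → F) i w.1) := by
      rw [diagonalUnits_val]
      congr 1
      ext k
      by_cases hk : k = i <;> simp [hk]
    simpa only [Function.comp_def, hval] using (hc.tendsto u.1).comp hv
  · simpa using diagonalUnits_mulSingle_pow_mem N hc ht i (v k)

/-! ### Rational points in the real general linear group -/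

section RealPoints

variable (F : Subfield ℝ) (n : ℕ)

/-- The inclusion of `GL(n, F)` into `GL(n, ℝ)` for a subfield `F` of `ℝ`. -/
noncomputable abbrev toRealGL : GL (Fin n) F →* GL (Fin n) ℝ := GeneralLinearGroup.map F.subtype

theorem isEmbedding_toRealGL : IsEmbedding (toRealGL F n) := by
  rw [← (GL_isEmbedding_val n ℝ).of_comp_iff]
  exact (IsEmbedding.subtypeVal.matrix_map (m := Fin n) (n := Fin n)).comp (GL_isEmbedding_val n F)

theorem denseRange_toRealGL : DenseRange (toRealGL F n) := by
  intro A
  have hdF : DenseRange F.subtype :=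
    Rat.denseRange_cast.mono (by rintro _ ⟨q, rfl⟩; exact ⟨q, by simp⟩)
  have hd : DenseRange (fun M : Matrix (Fin n) (Fin n) F => M.map F.subtype) :=
    DenseRange.piMap fun _ => DenseRange.piMap fun _ => hdF
  set φ := fun M : Matrix (Fin n) (Fin n) F => M.map F.subtype
  let l := comap φ (𝓝 A.1)
  have : l.NeBot := comap_neBot fun t ht => by
    obtain ⟨_, h, M, rfl⟩ := mem_closure_iff_nhds.1 (hd A.1) t ht
    exact ⟨M, h⟩
  have hl : Tendsto φ l (𝓝 A.1) := tendsto_comap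
  have hdet : ∀ᶠ M in l, (φ M).det ≠ 0 :=
    ((continuous_id.matrix_det.tendsto A.1).comp hl).eventually_ne
      (GeneralLinearGroup.det_ne_zero A)
  let f : Matrix (Fin n) (Fin n) F → GL (Fin n) F := fun M =>
    if h : M.det ≠ 0 then GeneralLinearGroup.mkOfDetNeZero M h else 1
  refine mem_closure_of_tendsto (f := toRealGL F n ∘ f) (b := l) ?_ (.of_forall fun M => ⟨_, rfl⟩)
  rw [(GL_isEmbedding_val n ℝ).tendsto_nhds_iff]
  refine hl.congr' ?_
  filter_upwards [hdet] with M hM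
  have hM' : M.det ≠ 0 := fun h => hM (by
    change (F.subtype.mapMatrix M).det = 0
    rw [← RingHom.map_det, h, map_zero])
  simp only [Function.comp_apply, f, dif_pos hM']
  rfl

variable {n}

/-- Bounded families of matrices converge along ultrafilters. -/
theorem Ultrafilter.exists_tendsto_matrix {α : Type*} (U : Ultrafilter α)
    (f : α → Matrix (Fin n) (Fin n) ℝ) (C : ℝ) (h : ∀ᶠ x in U, ∀ i j, |f x i j| ≤ C) :
    ∃ A, Tendsto f U (𝓝 A) := by
  have (i j : Fin n) : ∃ a, Tendsto (fun x => f x i j) U (𝓝 a) := by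
    obtain ⟨a, -, ha⟩ := (isCompact_Icc (a := -C) (b := C)).ultrafilter_le_nhds'
      (U.map fun x => f x i j) (h.mono fun x hx => abs_le.1 (hx i j))
    exact ⟨a, ha⟩
  choose A hA using this
  exact ⟨A, tendsto_pi_nhds.2 fun i => tendsto_pi_nhds.2 fun j => hA i j⟩

end RealPoints

/-! ### The limit subgroup of a group topology on the projective linear group -/

section LimitGroup

variable {F : Subfield ℝ} {n : ℕ} {Q : Type*} [Group Q] [TopologicalSpace Q]
  [IsTopologicalGroup Q] (π : GL (Fin n) F →* Q)

omit [IsTopologicalGroup Q] in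
theorem mapClusterPt_toRealGL_iff {A : GL (Fin n) ℝ} :
    MapClusterPt A (comap π (𝓝 1)) (toRealGL F n) ↔ ∃ l : Filter (GL (Fin n) F), l.NeBot ∧
      Tendsto π l (𝓝 1) ∧ Tendsto (toRealGL F n) l (𝓝 A) := by
  constructor
  · intro h
    obtain ⟨U, hU, hA⟩ := mapClusterPt_iff_ultrafilter.1 h
    exact ⟨U, U.neBot, tendsto_iff_comap.2 hU, hA⟩
  · rintro ⟨l, hl, h1, h2⟩
    exact h2.mapClusterPt.mono (tendsto_iff_comap.1 h1)

/-- The subgroup of `GL(n, ℝ)` of all limits of filters on `GL(n, F)` along which `π` tends to `1`,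
where `π` is a homomorphism to a topological group. -/
def limitSubgroup : Subgroup (GL (Fin n) ℝ) where
  carrier := {A | MapClusterPt A (comap π (𝓝 1)) (toRealGL F n)}
  one_mem' := (mapClusterPt_toRealGL_iff π).2 ⟨pure 1, inferInstance,
    by simpa using tendsto_pure_nhds π 1, by simpa using tendsto_pure_nhds (toRealGL F n) 1⟩
  mul_mem' := by
    intro A B hA hB
    obtain ⟨l, hl, hl1, hlA⟩ := (mapClusterPt_toRealGL_iff π).1 hA
    obtain ⟨m, hm, hm1, hmB⟩ := (mapClusterPt_toRealGL_iff π).1 hB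
    refine (mapClusterPt_toRealGL_iff π).2
      ⟨map (fun p => p.1 * p.2) (l ×ˢ m), inferInstance, ?_, ?_⟩
    · simpa [Function.comp_def] using (hl1.comp tendsto_fst).mul (hm1.comp (tendsto_snd (f := l)))
    · simpa [Function.comp_def] using (hlA.comp tendsto_fst).mul (hmB.comp (tendsto_snd (f := l)))
  inv_mem' := by
    intro A hA
    obtain ⟨l, hl, hl1, hlA⟩ := (mapClusterPt_toRealGL_iff π).1 hA
    refine (mapClusterPt_toRealGL_iff π).2 ⟨map (fun p => p⁻¹) l, inferInstance, ?_, ?_⟩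
    · rw [tendsto_map'_iff]
      simpa [Function.comp_def] using hl1.inv
    · rw [tendsto_map'_iff]
      simpa only [Function.comp_def, map_inv] using hlA.inv

theorem mem_limitSubgroup_iff {A : GL (Fin n) ℝ} :
    A ∈ limitSubgroup π ↔ ∃ l : Filter (GL (Fin n) F), l.NeBot ∧
      Tendsto π l (𝓝 1) ∧ Tendsto (toRealGL F n) l (𝓝 A) := mapClusterPt_toRealGL_iff π

theorem isClosed_limitSubgroup : IsClosed (limitSubgroup π : Set (GL (Fin n) ℝ)) :=
  isClosed_setOfPred_clusterPt

/-- The normalizer of the limit subgroup is closed and contains the dense subgroup `GL(n, F)`. -/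
instance normal_limitSubgroup : (limitSubgroup π).Normal where
  conj_mem A hA g := by
    have hcl : IsClosed {g : GL (Fin n) ℝ | g * A * g⁻¹ ∈ limitSubgroup π} :=
      (isClosed_limitSubgroup π).preimage (by fun_prop)
    refine (denseRange_toRealGL F n).induction_on g hcl fun h => ?_
    obtain ⟨l, hl, hl1, hlA⟩ := (mem_limitSubgroup_iff π).1 hA
    refine (mem_limitSubgroup_iff π).2 ⟨map (fun p => h * p * h⁻¹) l, inferInstance, ?_, ?_⟩
    · simpa [Function.comp_def] using (hl1.const_mul (π h)).mul_const (π h)⁻¹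
    · simpa [Function.comp_def] using (hlA.const_mul (toRealGL F n h)).mul_const (toRealGL F n h)⁻¹

variable {π} [T2Space Q]

/-- At an `F`-rational point `a` of the limit subgroup, `π` has the two limits `π a` and `1`. -/
theorem eq_one_of_toRealGL_mem_limitSubgroup (hπ : Continuous π) {a : GL (Fin n) F}
    (ha : toRealGL F n a ∈ limitSubgroup π) : π a = 1 := by
  obtain ⟨l, hl, hl1, hla⟩ := (mem_limitSubgroup_iff π).1 ha
  have : Tendsto id l (𝓝 a) := (isEmbedding_toRealGL F n).tendsto_nhds_iff.2 hla
  exact tendsto_nhds_unique ((hπ.tendsto a).comp this) hl1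

/-- Otherwise the limit subgroup contains elementary transvections, which are defined over `F`. -/
theorem limitSubgroup_le_center (hn : 3 ≤ n) (hπ : Continuous π)
    (hker : π.ker ≤ Subgroup.center _) : limitSubgroup π ≤ Subgroup.center _ := by
  intro A hA
  by_contra hAc
  let i : Fin n := ⟨0, by omega⟩
  let j : Fin n := ⟨1, by omega⟩
  have hij : i ≠ j := by simp [i, j]
  obtain ⟨x, hx, hxe⟩ := transvection_mem_of_notMem_center (limitSubgroup π) (by simpa using hn)
    hA hAc ⟨i, j, hij, 1⟩
  let t : TransvectionStruct (Fin n) F := ⟨i, j, hij, 1⟩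
  let a : GL (Fin n) F := ⟨t.toMatrix, t.inv.toMatrix, t.mul_inv, t.inv_mul⟩
  have hax : toRealGL F n a = x := by
    apply Units.ext
    rw [hxe]
    ext k l
    simp [a, t, TransvectionStruct.toMatrix, transvection, one_apply, single_apply]
    split_ifs <;> simp
  have h1 := eq_one_of_toRealGL_mem_limitSubgroup hπ (a := a) (hax ▸ hx)
  obtain ⟨s, hs⟩ := GeneralLinearGroup.mem_center_iff_val_mem_range_scalar.1 (hker h1)
  have h2 := congrFun (congrFun hs i) j
  simp [a, t, TransvectionStruct.toMatrix, transvection, hij] at h2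

end LimitGroup

theorem mul_single_mul_apply {ι R : Type*} [Fintype ι] [DecidableEq ι] [CommRing R]
    (A B : Matrix ι ι R) (i j k l : ι) (c : R) :
    (A * single i j c * B) k l = A k i * c * B j l := by
  have : single i j c = vecMulVec (Pi.single i c) (Pi.single j 1) := by
    ext a b
    by_cases ha : i = a <;> by_cases hb : j = b <;>
      simp_all [vecMulVec_apply, eq_comm]
  rw [this, mul_vecMulVec, vecMulVec_mul, vecMulVec_apply]
  simp

/-! ### Minimality -/

section Minimality

variable {F : Subfield ℝ} {n : ℕ} {Q : Type*} [Group Q] [TopologicalSpace Q]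
  [IsTopologicalGroup Q] [T2Space Q] {π : GL (Fin n) F →* Q}

omit [T2Space Q] in
theorem mkOfDetNeZero_mem_limitSubgroup {l : Filter (GL (Fin n) F)} [l.NeBot]
    {f : GL (Fin n) F → GL (Fin n) F} (hf : Tendsto (fun g => π (f g)) l (𝓝 1))
    {A : Matrix (Fin n) (Fin n) ℝ} (hA : A.det ≠ 0)
    (hfA : Tendsto (fun g => (toRealGL F n (f g)).1) l (𝓝 A)) :
    GeneralLinearGroup.mkOfDetNeZero A hA ∈ limitSubgroup π := by
  refine (mem_limitSubgroup_iff π).2 ⟨map f l, inferInstance, tendsto_map'_iff.2 hf, ?_⟩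
  rw [(GL_isEmbedding_val n ℝ).tendsto_nhds_iff, tendsto_map'_iff]
  exact hfA

/-- The products of an entry of `g` and an entry of `g⁻¹` stay bounded as `π g` tends to `1`. -/
theorem exists_eventually_abs_mul_inv_le (hn : 3 ≤ n) (hπ : Continuous π)
    (hker : π.ker ≤ Subgroup.center _) :
    ∃ C : ℝ, ∀ᶠ g in comap π (𝓝 1), ∀ a i j b : Fin n, |((g.1 a i * g⁻¹.1 j b : F) : ℝ)| ≤ C := by
  have : Nonempty (Fin n) := ⟨⟨0, by omega⟩⟩
  by_contra! hcon
  let val (g : GL (Fin n) F) (p : Fin n × Fin n × Fin n × Fin n) : F :=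
    g.1 p.1 p.2.1 * g⁻¹.1 p.2.2.1 p.2.2.2
  choose p hp using fun g : GL (Fin n) F => Finite.exists_max fun q => |(val g q : ℝ)|
  let m (g : GL (Fin n) F) : ℝ := |(val g (p g) : ℝ)|
  have hne : (comap π (𝓝 1) ⊓ comap m atTop).NeBot := by
    refine inf_neBot_iff.2 fun s hs s' hs' => ?_
    obtain ⟨t, ht, hts⟩ := mem_comap.1 hs'
    obtain ⟨C, hC⟩ := mem_atTop_sets.1 ht
    obtain ⟨g, hgs, hg⟩ := ((frequently_iff.1 (hcon C)) hs)
    obtain ⟨a, i, j, b, hg⟩ := hg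
    exact ⟨g, hgs, hts (hC _ (hg.le.trans (hp g (a, i, j, b))))⟩
  obtain ⟨U, hU⟩ := exists_ultrafilter_le (comap π (𝓝 1) ⊓ comap m atTop)
  have hU1 : Tendsto π U (𝓝 1) := tendsto_iff_comap.2 (hU.trans inf_le_left)
  have hUm : Tendsto m U atTop := tendsto_iff_comap.2 (hU.trans inf_le_right)
  -- The inverse of the largest product lies in `F`, so `g x g⁻¹` below has an entry that differs from
  -- that of the identity by exactly `1`.
  let c (g : GL (Fin n) F) : F := (val g (p g))⁻¹
  have hc : Tendsto (fun g => |(c g : ℝ)|) U (𝓝 0) := by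
    refine (tendsto_inv_atTop_zero.comp hUm).congr fun g => ?_
    simp [m, c]
  let X (g : GL (Fin n) F) : Matrix (Fin n) (Fin n) F :=
    1 + single (p g).2.1 (p g).2.2.1 (c g)
  have hX : Tendsto X U (𝓝 1) := by
    have : Tendsto (fun g => single (p g).2.1 (p g).2.2.1 (c g)) U (𝓝 0) := by
      refine tendsto_pi_nhds.2 fun k => tendsto_pi_nhds.2 fun l => tendsto_subtype_rng.2 ?_
      refine squeeze_zero_norm (fun g => ?_) hc
      by_cases h : (p g).2.1 = k ∧ (p g).2.2.1 = l
      · simp [h]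
      · simp [h]
    simpa [X] using this.const_add 1
  have hXdet : Tendsto (fun g => (X g).det) U (𝓝 1) := by
    simpa [Function.comp_def] using
      (continuous_id.matrix_det.tendsto (1 : Matrix (Fin n) (Fin n) F)).comp hX
  have hXne : ∀ᶠ g in U, (X g).det ≠ 0 := hXdet.eventually_ne one_ne_zero
  let x (g : GL (Fin n) F) : GL (Fin n) F :=
    if h : (X g).det ≠ 0 then GeneralLinearGroup.mkOfDetNeZero (X g) h else 1
  have hxX : ∀ᶠ g in U, (x g).1 = X g := by
    filter_upwards [hXne] with g hg
    simp only [x, dif_pos hg]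
    rfl
  have hx : Tendsto x U (𝓝 1) := by
    rw [(GL_isEmbedding_val n F).tendsto_nhds_iff]
    exact hX.congr' (hxX.mono fun g hg => hg.symm)
  let R (g : GL (Fin n) F) : Matrix (Fin n) (Fin n) ℝ :=
    of fun k l => ((g.1 k (p g).2.1 * c g * g⁻¹.1 (p g).2.2.1 l : F) : ℝ)
  have hyR : ∀ᶠ g in U, (toRealGL F n (g * x g * g⁻¹)).1 = 1 + R g := by
    filter_upwards [hxX] with g hg
    have h1 : (g * x g * g⁻¹).1 = 1 + g.1 * single (p g).2.1 (p g).2.2.1 (c g) * g⁻¹.1 := by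
      rw [Units.val_mul, Units.val_mul, hg]
      simp only [X, mul_add, add_mul, mul_one, Units.mul_inv]
    have h2 : (toRealGL F n (g * x g * g⁻¹)).1 = (g * x g * g⁻¹).1.map F.subtype := rfl
    rw [h2, h1]
    ext k l
    rw [map_apply, Matrix.add_apply, Matrix.add_apply, mul_single_mul_apply, map_add]
    by_cases hkl : k = l <;> simp [R, one_apply, hkl]
  have hm0 : ∀ᶠ g in U, 0 < m g := hUm.eventually_gt_atTop 0
  have hR (g : GL (Fin n) F) (k l : Fin n) :
      |R g k l| = (m g)⁻¹ * |(val g (k, (p g).2.1, (p g).2.2.1, l) : ℝ)| := by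
    simp [R, m, val, c, abs_mul, abs_inv]
    ring
  have hRle : ∀ᶠ g in U, ∀ k l, |R g k l| ≤ 1 := by
    filter_upwards [hm0] with g hg k l
    rw [hR, inv_mul_le_one₀ hg]
    exact hp g _
  have hR1 : ∀ᶠ g in U, ∃ k l, 1 ≤ |R g k l| := by
    filter_upwards [hm0] with g hg
    refine ⟨(p g).1, (p g).2.2.2, ?_⟩
    rw [hR]
    exact (inv_mul_cancel₀ hg.ne').ge
  obtain ⟨S, hS⟩ := U.exists_tendsto_matrix R 1 hRle
  have hSkl (k l : Fin n) : Tendsto (fun g => R g k l) U (𝓝 (S k l)) :=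
    tendsto_pi_nhds.1 (tendsto_pi_nhds.1 hS k) l
  have hS0 : S ≠ 0 := by
    rintro rfl
    have : ∀ᶠ g in U, ∀ k l, |R g k l| < 1 := by
      refine eventually_all.2 fun k => eventually_all.2 fun l => ?_
      have := (hSkl k l).abs
      rw [Matrix.zero_apply, abs_zero] at this
      exact this.eventually_lt_const one_pos
    obtain ⟨g, ⟨k, l, hkl⟩, hg⟩ := (hR1.and this).exists
    exact absurd (hg k l) (not_lt.2 hkl)
  -- `R g` has rank at most one, hence so has its limit `S`.
  have hminor (k l k' l' : Fin n) : S k l * S k' l' = S k l' * S k' l := by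
    refine tendsto_nhds_unique ((hSkl k l).mul (hSkl k' l')) ?_
    refine ((hSkl k l').mul (hSkl k' l)).congr fun g => ?_
    simp only [R, of_apply]
    push_cast
    ring
  have hlim : Tendsto (fun g => (toRealGL F n (g * x g * g⁻¹)).1) U (𝓝 (1 + S)) :=
    (hS.const_add 1).congr' (hyR.mono fun g hg => hg.symm)
  have hdet : (1 + S).det = 1 := by
    refine tendsto_nhds_unique ((continuous_id.matrix_det.tendsto (1 + S)).comp hlim) ?_
    refine (((continuous_subtype_val.tendsto _).comp hXdet)).congr' ?_
    filter_upwards [hxX] with g hg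
    simp only [Function.comp_apply, ← hg]
    change _ = (F.subtype.mapMatrix (g * x g * g⁻¹).1).det
    rw [← RingHom.map_det, Units.val_mul, Units.val_mul, det_mul, det_mul, mul_right_comm, ← det_mul,
      Units.mul_inv, det_one, one_mul]
    rfl
  have hmem := mkOfDetNeZero_mem_limitSubgroup (π := π) (l := U) (f := fun g => g * x g * g⁻¹)
    (by
      have := (hU1.mul ((hπ.tendsto 1).comp hx)).mul hU1.inv
      simpa [Function.comp_def] using this) (by rw [hdet]; exact one_ne_zero) hlim
  obtain ⟨s, hs⟩ := GeneralLinearGroup.mem_center_iff_val_mem_range_scalar.1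
    (limitSubgroup_le_center hn hπ hker hmem)
  have hs' : S = scalar (Fin n) (s - 1) := by
    have : scalar (Fin n) s = 1 + S := hs
    rw [map_sub, map_one, this]; abel
  -- `S` is scalar, so the minor at the first two rows and columns is the square of the scalar.
  let i0 : Fin n := ⟨0, by omega⟩
  let i1 : Fin n := ⟨1, by omega⟩
  have hi : i0 ≠ i1 := by simp [i0, i1]
  have := hminor i0 i0 i1 i1
  rw [hs'] at this
  simp [hi] at this
  exact hS0 (by rw [hs', this, map_zero])

/-- Along an ultrafilter on which `π g` tends to `1`, suitable scalar multiples of `g` tend to `1` in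
`GL(n, F)`. -/
theorem exists_lift_tendsto_one (hn : 3 ≤ n) (hπ : Continuous π)
    (hker : π.ker = Subgroup.center _) (U : Ultrafilter (GL (Fin n) F))
    (hU : Tendsto π U (𝓝 1)) :
    ∃ f : GL (Fin n) F → GL (Fin n) F, (∀ g, π (f g) = π g) ∧ Tendsto f U (𝓝 1) := by
  have : Nonempty (Fin n) := ⟨⟨0, by omega⟩⟩
  obtain ⟨C, hC⟩ := exists_eventually_abs_mul_inv_le hn hπ hker.le
  replace hC := (tendsto_iff_comap.1 hU) hC
  choose p hp using fun g : GL (Fin n) F =>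
    Finite.exists_max fun q : Fin n × Fin n => |(g.1 q.1 q.2 : ℝ)|
  -- The entry of `g` of largest absolute value, by which `g` is divided.
  let e (g : GL (Fin n) F) : F := g.1 (p g).1 (p g).2
  have he (g : GL (Fin n) F) : e g ≠ 0 := by
    intro h0
    apply g.ne_zero
    ext k l
    have := hp g (k, l)
    change _ ≤ |(e g : ℝ)| at this
    rw [h0] at this
    simpa using this
  let f (g : GL (Fin n) F) : GL (Fin n) F :=
    g * GeneralLinearGroup.scalar (Fin n) (Units.mk0 (e g) (he g))⁻¹
  have hfπ (g : GL (Fin n) F) : π (f g) = π g := by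
    have : GeneralLinearGroup.scalar (Fin n) (Units.mk0 (e g) (he g))⁻¹ ∈ π.ker := by
      rw [hker, GeneralLinearGroup.center_eq_range_scalar]
      exact ⟨_, rfl⟩
    rw [map_mul, this, mul_one]
  have hfv (g : GL (Fin n) F) (k l : Fin n) : (f g).1 k l = g.1 k l * (e g)⁻¹ :=
    mul_diagonal (d := fun _ => (e g)⁻¹) (M := g.1) k l
  have hfi (g : GL (Fin n) F) (k l : Fin n) : (f g)⁻¹.1 k l = e g * g⁻¹.1 k l := by
    have : (f g)⁻¹ = GeneralLinearGroup.scalar (Fin n) (Units.mk0 (e g) (he g)) * g⁻¹ := by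
      simp only [f, _root_.mul_inv_rev, map_inv, inv_inv]
    rw [this]
    exact diagonal_mul (d := fun _ => e g) (M := g⁻¹.1) k l
  obtain ⟨A, hA⟩ := U.exists_tendsto_matrix (fun g => (toRealGL F n (f g)).1) 1
    (.of_forall fun g k l => by
      change |((f g).1 k l : ℝ)| ≤ 1
      rw [hfv, Subfield.coe_mul, Subfield.coe_inv, abs_mul, abs_inv, ← div_eq_mul_inv]
      exact div_le_one_of_le₀ (hp g (k, l)) (abs_nonneg _))
  obtain ⟨B, hB⟩ := U.exists_tendsto_matrix (fun g => (toRealGL F n (f g)⁻¹).1) C (by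
      filter_upwards [hC] with g hg k l
      change |((f g)⁻¹.1 k l : ℝ)| ≤ C
      rw [hfi]
      exact hg _ _ _ _)
  have hAB : A * B = 1 := by
    refine tendsto_nhds_unique (hA.mul hB) (tendsto_const_nhds.congr fun g => ?_)
    rw [← Units.val_mul, ← map_mul, mul_inv_cancel, map_one, Units.val_one]
  have hdet : A.det ≠ 0 := fun h => by
    simpa [h] using congrArg det hAB
  have hmem := mkOfDetNeZero_mem_limitSubgroup (π := π) (l := U) (f := f)
    (by simpa only [hfπ] using hU) hdet hA
  obtain ⟨s, hs⟩ := GeneralLinearGroup.mem_center_iff_val_mem_range_scalar.1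
    (limitSubgroup_le_center hn hπ hker.le hmem)
  replace hs : scalar (Fin n) s = A := hs
  -- Having an entry `1` is a closed condition, which the normalized matrices satisfy.
  have hone : A ∈ {M : Matrix (Fin n) (Fin n) ℝ | ∃ k l, M k l = 1} := by
    have hcl : IsClosed {M : Matrix (Fin n) (Fin n) ℝ | ∃ k l, M k l = 1} := by
      simp only [Set.ofPred_exists]
      exact isClosed_iUnion_of_finite fun k => isClosed_iUnion_of_finite fun l =>
        isClosed_eq (continuous_id.matrix_elem k l) continuous_const
    refine hcl.mem_of_tendsto hA (.of_forall fun g => ⟨(p g).1, (p g).2, ?_⟩)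
    change ((f g).1 _ _ : ℝ) = 1
    rw [hfv]
    exact congrArg Subtype.val (mul_inv_cancel₀ (he g))
  have hA1 : A = 1 := by
    obtain ⟨k, l, hkl⟩ := hone
    have : s = 1 := by
      rw [← hs] at hkl
      by_cases h : k = l <;> simp_all
    rw [← hs, this, map_one]
  refine ⟨f, hfπ, ?_⟩
  rw [(isEmbedding_toRealGL F n).tendsto_nhds_iff, map_one,
    (GL_isEmbedding_val n ℝ).tendsto_nhds_iff]
  rw [hA1] at hA
  exact hA

end Minimality

/-! ### Total minimality of the projective linear group -/

theorem isMinimalGroup_of_subsingleton (G : Type*) [Group G] [TopologicalSpace G]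
    [IsTopologicalGroup G] [Subsingleton G] : IsMinimalGroup G :=
  ⟨inferInstance, fun _ _ _ _ => Subsingleton.elim _ _⟩

/-- A Hausdorff group that is the image of `GL(n, F)` under a continuous homomorphism `π` whose kernel
consists of the scalars is minimal. It is not assumed that `π` is open. -/
theorem isMinimalGroup_of_surjective {F : Subfield ℝ} {n : ℕ} (hn : 3 ≤ n) {Q : Type*} [Group Q]
    [σ : TopologicalSpace Q] [IsTopologicalGroup Q] [T2Space Q] (π : GL (Fin n) F →* Q)
    (hπ : Continuous π) (hsurj : Function.Surjective π) (hker : π.ker = Subgroup.center _) :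
    IsMinimalGroup Q := by
  have hπ1 : Tendsto π (𝓝 1) (𝓝 1) := by simpa using hπ.tendsto 1
  refine ⟨inferInstance, fun τ hστ hτ hτ2 => ?_⟩
  refine IsTopologicalGroup.ext hτ inferInstance (le_antisymm ?_ (nhds_mono hστ))
  refine le_iff_ultrafilter.2 fun V hV => ?_
  have : (comap π (V : Filter Q)).NeBot := V.neBot.comap_of_surj hsurj
  obtain ⟨U, hU⟩ := exists_ultrafilter_le (comap π (V : Filter Q))
  have hUV : U.map π = V := Ultrafilter.coe_le_coe.1 (map_le_iff_le_comap.2 hU)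
  obtain ⟨f, hf, hf1⟩ := @exists_lift_tendsto_one F n Q _ τ hτ hτ2 π hn
    (continuous_le_rng hστ hπ) hker U (by
      rw [Tendsto, ← Ultrafilter.coe_map, hUV]; exact hV)
  rw [← hUV, Ultrafilter.coe_map]
  exact (hπ1.comp hf1).congr hf

theorem proposition5p16 (F : Subfield ℝ) (n : ℕ) (hn : Odd n) :
    IsTotallyMinimalGroup (Matrix.ProjGenLinGroup (Fin n) F) := by
  have hT2GL : T2Space (GL (Fin n) F) := (GL_isEmbedding_val n F).t2Space
  have hT2 : T2Space (Matrix.ProjGenLinGroup (Fin n) F) := by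
    have : IsClosed (Subgroup.center (GL (Fin n) F) : Set (GL (Fin n) F)) := by
      rw [Subgroup.coe_center, ← Set.centralizer_univ]
      exact Set.isClosed_centralizer _
    exact inferInstanceAs (T2Space (GL (Fin n) F ⧸ Subgroup.center (GL (Fin n) F)))
  refine ⟨hT2, fun N hN hcl => ?_⟩
  have hmk : Continuous (ProjGenLinGroup.mk : GL (Fin n) F → ProjGenLinGroup (Fin n) F) :=
    continuous_quotient_mk'
  rcases hn.pos.nat_succ_le.eq_or_lt with rfl | h1
  · have : Subsingleton (ProjGenLinGroup (Fin (Nat.succ 0)) F) := by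
      refine subsingleton_of_forall_eq 1 fun x => ?_
      obtain ⟨g, rfl⟩ := ProjGenLinGroup.mk_surjective x
      rw [ProjGenLinGroup.mk_eq_one, GeneralLinearGroup.mem_center_iff_val_mem_range_scalar]
      refine ⟨g.1 0 0, ?_⟩
      ext i j
      simp [Subsingleton.elim i 0, Subsingleton.elim j 0]
    have : Subsingleton (ProjGenLinGroup (Fin (Nat.succ 0)) F ⧸ N) :=
      (QuotientGroup.mk'_surjective N).subsingleton
    exact isMinimalGroup_of_subsingleton _
  have hn3 : 3 ≤ n := by
    obtain ⟨k, rfl⟩ := hn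
    omega
  rcases eq_or_ne N ⊥ with hbot | hbot
  · have := hcl
    refine isMinimalGroup_of_surjective hn3
      ((QuotientGroup.mk' N).comp ProjGenLinGroup.mk)
      (continuous_quotient_mk'.comp hmk)
      ((QuotientGroup.mk'_surjective N).comp ProjGenLinGroup.mk_surjective) ?_
    rw [← MonoidHom.comap_ker, QuotientGroup.ker_mk', hbot, MonoidHom.comap_bot,
      ProjGenLinGroup.ker_mk]
  · obtain ⟨y, hy, hy1⟩ := (Subgroup.bot_or_exists_ne_one N).resolve_left hbot
    obtain ⟨A, rfl⟩ := ProjGenLinGroup.mk_surjective y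
    have htop : N.comap ProjGenLinGroup.mk = ⊤ :=
      eq_top_of_isClosed_of_notMem_center F n hn hn3 _
        (by rw [← ProjGenLinGroup.ker_mk]; exact Subgroup.ker_le_comap _ _)
        (hcl.preimage hmk) (A := A) hy (fun h => hy1 (ProjGenLinGroup.mk_eq_one.2 h))
    have hN : N = ⊤ := by
      rw [← Subgroup.map_comap_eq_self_of_surjective ProjGenLinGroup.mk_surjective N, htop,
        Subgroup.map_top_of_surjective _ ProjGenLinGroup.mk_surjective]
    have : Subsingleton (ProjGenLinGroup (Fin n) F ⧸ N) :=
      QuotientGroup.subsingleton_iff.2 hN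
    exact isMinimalGroup_of_subsingleton _
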